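/- Let $(V,Y,\mathbf 1,\omega)$ be a simple vertex operator algebra over $\mathbb C$ (that is, $V\ne 0$ and its only ideals are $0$ and $V$), and let $g$ be an automorphism of $V$ of finite order $K$. For $r\in\mathbb Z/K\mathbb Z$ put $V^r=\{v\in V : gv=e^{2\pi i r/K}v\}$; in particular $V^0$ is the vertex operator subalgebra of $g$-fixed points. Let $\mathcal C_g$ be the category of $g$-twisted $V$-modules. Its objects are the $\mathbb C$-graded spaces $M=\coprod_{\lambda\in\mathbb C}M_\lambda$ with all $M_\lambda$ finite dimensional and, for each $\lambda$, $M_{\lambda+n}=0$ for $n\in\mathbb Z$ sufficiently small, equipped with a linear map $v\mapsto Y_M(v,z)=\sum_{n\in\mathbb Q}v_nz^{-n-1}$, $v_n\in\operatorname{End}M$, such that: - $Y_M(v,z)=\sum_{n\in r/K+\mathbb Z}v_nz^{-n-1}$ for $v\in V^r$; - for all $v\in V$ and $w\in M$, $v_nw=0$ for $n$ sufficiently large; - $Y_M(\mathbf 1,z)=1$; - for $u\in V^r$ and $v\in V$ the twisted Jacobi identity holds: $$z_0^{-1}\delta\!\left(\tfrac{z_1-z_2}{z_0}\right)Y_M(u,z_1)Y_M(v,z_2)-z_0^{-1}\delta\!\left(\tfrac{z_2-z_1}{-z_0}\right)Y_M(v,z_2)Y_M(u,z_1)=z_2^{-1}\left(\tfrac{z_1-z_0}{z_2}\right)^{-r/K}\delta\!\left(\tfrac{z_1-z_0}{z_2}\right)Y_M(Y(u,z_0)v,z_2);$$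 - the operators $L(n)=\omega_{n+1}$, $n\in\mathbb Z$, satisfy the Virasoro relations with central charge $\operatorname{rank}V$, $L(0)$ acts on $M_\lambda$ as $\lambda$, and $\frac{d}{dz}Y_M(v,z)=Y_M(L(-1)v,z)$. Its morphisms are the linear maps commuting with all $v_n$. A module in $\mathcal C_g$ is irreducible if it is nonzero and its only subspaces invariant under all $v_n$ are $0$ and itself. If $M\in\mathcal C_g$ is irreducible, it has a unique minimal weight $\lambda$, where a weight $\lambda$ (i.e. $M_\lambda\neq 0$) is minimal if no weight $\mu\ne\lambda$ satisfies $0\le\lambda-\mu\in\frac1K\mathbb Z$. For $r\in\mathbb Z/K\mathbb Z$ put $$M^r=\bigoplus_{n\in\mathbb Z}M_{\lambda-\frac rK+n}.$$ Each $M^r$ is an (untwisted) $V^0$-module under the operators $v_n$ with $v\in V^0$, $n\in\mathbb Z$, and $M=M^0\oplus\dots\oplus M^{K-1}$; the $M^r$ are called the $V^0$-components of $M$. **Theorem.** Let $M$ and $N$ be irreducible modules in $\mathcal C_g$. If for some $r,s\in\mathbb Z/K\mathbb Z$ the component $M^r$ is isomorphic to the component $N^s$ as a $V^0$-module, then $M\cong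 N$ in $\mathcal C_g$. -/

import Mathlib

noncomputable section

/-- A vertex operator algebra structure on a complex vector space `V`. The vertex operator of `v`
is `Y(v,z) = ∑_{n ∈ ℤ} v_n z^{-n-1}`, with `v_n = mode n v`; the graded pieces are `V_n = wt n`. -/
structure VertexOperatorAlgebra (V : Type*) [AddCommGroup V] [Module ℂ V] where
  wt : ℤ → Submodule ℂ V
  isInternal : DirectSum.IsInternal wt
  finiteDimensional : ∀ n, FiniteDimensional ℂ (wt n)
  bounded : ∃ n₀ : ℤ, ∀ n ≤ n₀, wt n = ⊥
  mode : ℤ → V →ₗ[ℂ] Module.End ℂ V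
  vacuum : V
  omega : V
  rank : ℂ
  truncation : ∀ u v : V, ∃ n₀ : ℤ, ∀ n ≥ n₀, mode n u v = 0
  vacuum_mem : vacuum ∈ wt 0
  omega_mem : omega ∈ wt 2
  /-- `Y(𝟏,z) = 1`. -/
  mode_vacuum : ∀ (n : ℤ) (v : V), mode n vacuum v = if n = -1 then v else 0
  /-- `Y(v,z)𝟏` is a power series in `z` ... -/
  creation_nonneg : ∀ (v : V) (n : ℤ), 0 ≤ n → mode n v vacuum = 0
  /-- ... with constant term `v`. -/
  creation : ∀ v : V, mode (-1) v vacuum = v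
  /-- The Jacobi identity, coefficientwise. By `truncation` all the sums are finite. -/
  jacobi : ∀ (u v w : V) (p s t : ℤ),
    ∑ᶠ m : ℕ, ((-1 : ℂ) ^ m * Ring.choose (p : ℂ) m) •
        (mode (p + s - m) u (mode (t + m) v w)
          - (-1 : ℂ) ^ p • mode (p + t - m) v (mode (s + m) u w))
      = ∑ᶠ m : ℕ, Ring.choose (s : ℂ) m • mode (s + t - m) (mode (p + m) u v) w
  /-- The Virasoro relations for `L(n) = ω_{n+1}`. -/
  virasoro : ∀ (m n : ℤ) (w : V),
    mode (m + 1) omega (mode (n + 1) omega w) - mode (n + 1) omega (mode (m + 1) omega w)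
      = ((m : ℂ) - n) • mode (m + n + 1) omega w
        + (if m + n = 0 then ((m : ℂ) ^ 3 - m) / 12 * rank else 0) • w
  /-- `L(0)` acts on `V_n` as the scalar `n`. -/
  L_zero : ∀ (n : ℤ), ∀ v ∈ wt n, mode 1 omega v = (n : ℂ) • v
  /-- `d/dz Y(v,z) = Y(L(-1)v,z)`. -/
  L_neg_one : ∀ (v : V) (n : ℤ), mode n (mode 0 omega v) = (-(n : ℂ)) • mode (n - 1) v

namespace VertexOperatorAlgebra

variable {V : Type*} [AddCommGroup V] [Module ℂ V] (A : VertexOperatorAlgebra V)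

/-- `V` is simple: it is nonzero, and its only ideals (`V`-submodules) are `0` and `V`. -/
def IsSimple : Prop :=
  Nontrivial V ∧ ∀ I : Submodule ℂ V, (∀ (n : ℤ) (u : V), ∀ v ∈ I, A.mode n u v ∈ I) →
    I = ⊥ ∨ I = ⊤

/-- The group of automorphisms of a vertex operator algebra. -/
def aut : Subgroup (V ≃ₗ[ℂ] V) where
  carrier := {g | g A.vacuum = A.vacuum ∧ g A.omega = A.omega ∧
    ∀ (n : ℤ) (u v : V), g (A.mode n u v) = A.mode n (g u) (g v)}
  one_mem' := ⟨rfl, rfl, fun _ _ _ => rfl⟩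
  mul_mem' := by
    rintro a b ⟨a1, a2, a3⟩ ⟨b1, b2, b3⟩
    exact ⟨by simp [a1, b1], by simp [a2, b2], fun n u v => by simp [a3, b3]⟩
  inv_mem' := by
    rintro a ⟨a1, a2, a3⟩
    refine ⟨?_, ?_, fun n u v => ?_⟩
    · exact (LinearEquiv.symm_apply_eq a).2 a1.symm
    · exact (LinearEquiv.symm_apply_eq a).2 a2.symm
    · refine (LinearEquiv.symm_apply_eq a).2 ?_
      rw [a3]
      congr 1
      · congr 1
        exact (LinearEquiv.apply_symm_apply a u).symm
      · exact (LinearEquiv.apply_symm_apply a v).symm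

variable {A}

/-- `V^r = {v | g v = e^{2πir/K} v}`, where `K` is the order of `g`; it depends only on `r`
modulo `K`. -/
def eigen (g : A.aut) (r : ℤ) : Submodule ℂ V :=
  Module.End.eigenspace (g.1 : V →ₗ[ℂ] V)
    (Complex.exp (2 * Real.pi * Complex.I * r / (orderOf g : ℂ)))

theorem mem_eigen_zero (g : A.aut) (v : V) : v ∈ eigen g 0 ↔ g.1 v = v := by
  simp [eigen]

end VertexOperatorAlgebra

section Grading

variable {ι M : Type*} [AddCommGroup M] [Module ℂ M]

theorem mem_of_sum_mem {wt : ι → Submodule ℂ M} {c : ι → ℂ}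
    {T : Module.End ℂ M} (hT : ∀ i, ∀ x ∈ wt i, T x = c i • x) {W : Submodule ℂ M}
    (hc : Function.Injective c) (hW : ∀ x ∈ W, T x ∈ W) [DecidableEq ι] (s : Finset ι) :
    ∀ x : ι → M, (∀ i, x i ∈ wt i) → ∑ i ∈ s, x i ∈ W → ∀ i ∈ s, x i ∈ W := by
  induction s using Finset.induction_on with
  | empty => simp
  | insert j s hj ih =>
    intro x hx hs
    have h1 : ∑ i ∈ s, (c i - c j) • x i ∈ W := by
      have := W.sub_mem (hW _ hs) (W.smul_mem (c j) hs)
      rw [map_sum, Finset.smul_sum, ← Finset.sum_sub_distrib, Finset.sum_insert hj,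
        hT j _ (hx j), sub_self, zero_add] at this
      convert this using 2 with i hi
      rw [hT i _ (hx i), sub_smul]
    have h2 := ih (fun i => (c i - c j) • x i) (fun i => (wt i).smul_mem _ (hx i)) h1
    have h3 : ∀ i ∈ s, x i ∈ W := fun i hi => by
      have hne : c i - c j ≠ 0 := sub_ne_zero.2 fun h => hj (hc h ▸ hi)
      exact (W.smul_mem_iff hne).1 (h2 i hi)
    intro i hi
    rcases Finset.mem_insert.1 hi with rfl | hi
    · rw [Finset.sum_insert hj] at hs
      exact (W.add_mem_iff_left (W.sum_mem h3)).1 hs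
    · exact h3 i hi

theorem exists_decomp [DecidableEq ι] {wt : ι → Submodule ℂ M} (h : DirectSum.IsInternal wt)
    (x : M) : ∃ (s : Finset ι) (y : ι → M), (∀ i, y i ∈ wt i) ∧ ∑ i ∈ s, y i = x := by
  have hx : x ∈ ⨆ i, wt i := h.submodule_iSup_eq_top ▸ Submodule.mem_top
  obtain ⟨f, hf, rfl⟩ := (Submodule.mem_iSup_iff_exists_finsupp wt x).1 hx
  exact ⟨f.support, f, hf, rfl⟩

theorem isInternal_comap [DecidableEq ι] {wt : ι → Submodule ℂ M} (h : DirectSum.IsInternal wt)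
    {c : ι → ℂ} (hc : Function.Injective c) {T : Module.End ℂ M}
    (hT : ∀ i, ∀ x ∈ wt i, T x = c i • x) (W : Submodule ℂ M) (hW : ∀ x ∈ W, T x ∈ W) :
    DirectSum.IsInternal fun i => (wt i).comap W.subtype := by
  rw [DirectSum.isInternal_submodule_iff_iSupIndep_and_iSup_eq_top]
  constructor
  · refine ((Module.End.eigenspaces_iSupIndep (T.restrict hW)).comp hc).mono fun i x hx => ?_
    rw [Function.comp, Module.End.mem_eigenspace_iff]
    exact Subtype.ext (hT i _ hx)
  · rw [eq_top_iff]
    rintro ⟨x, hx⟩ -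
    obtain ⟨s, y, hy, rfl⟩ := exists_decomp h x
    have hyW := mem_of_sum_mem hT hc hW s y hy hx
    have : (⟨∑ i ∈ s, y i, hx⟩ : W) = ∑ i ∈ s.attach, ⟨y i, hyW i i.2⟩ := by
      apply Subtype.ext
      simp only [AddSubmonoidClass.coe_finsetSum]
      exact (Finset.sum_attach s y).symm
    rw [this]
    exact Submodule.sum_mem _ fun i _ =>
      Submodule.mem_iSup_of_mem (p := fun i => (wt i).comap W.subtype) i.1 (hy i)

theorem mem_wt_of_eigen [DecidableEq ι] {wt : ι → Submodule ℂ M} (h : DirectSum.IsInternal wt)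
    {c : ι → ℂ} (hc : Function.Injective c) {T : Module.End ℂ M}
    (hT : ∀ i, ∀ x ∈ wt i, T x = c i • x) (j : ι) (x : M) (hx : T x = c j • x) : x ∈ wt j := by
  obtain ⟨s, y, hy, rfl⟩ := exists_decomp h x
  have h1 : ∑ i ∈ s, (c i - c j) • y i ∈ (⊥ : Submodule ℂ M) := by
    rw [Submodule.mem_bot, ← sub_eq_zero.2 hx, map_sum, Finset.smul_sum,
      ← Finset.sum_sub_distrib]
    exact Finset.sum_congr rfl fun i _ => by rw [hT i _ (hy i), sub_smul]
  have h2 := mem_of_sum_mem (W := ⊥) hT hc (by simp) s (fun i => (c i - c j) • y i)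
    (fun i => (wt i).smul_mem _ (hy i)) h1
  refine Submodule.sum_mem _ fun i hi => ?_
  by_cases hij : i = j
  · exact hij ▸ hy i
  · have := h2 i hi
    rw [Submodule.mem_bot, smul_eq_zero] at this
    rcases this with h0 | h0
    · exact absurd (hc (sub_eq_zero.1 h0)) hij
    · rw [h0]; exact zero_mem _

theorem finiteDimensional_comap (U W : Submodule ℂ M) [FiniteDimensional ℂ U] :
    FiniteDimensional ℂ (U.comap W.subtype) :=
  FiniteDimensional.of_injective
    (W.subtype.restrict (p := U.comap W.subtype) (q := U) fun _ hx => hx)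
    fun _ _ hxy => Subtype.ext (Subtype.ext (congrArg (fun z : U => (z : M)) hxy))

theorem comap_subtype_eq_bot {U : Submodule ℂ M} (W : Submodule ℂ M) (h : U = ⊥) :
    U.comap W.subtype = ⊥ := by
  subst h
  simp

end Grading

namespace VertexOperatorAlgebra

variable {V : Type*} [AddCommGroup V] [Module ℂ V] {A : VertexOperatorAlgebra V}

/-- The restriction of a linear family of operators `f u` to an invariant subspace `W`. -/
def restrictMode {X M : Type*} [AddCommGroup X] [Module ℂ X] [AddCommGroup M] [Module ℂ M]
    (f : X →ₗ[ℂ] Module.End ℂ M) (W : Submodule ℂ M) (h : ∀ u, ∀ w ∈ W, f u w ∈ W) :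
    X →ₗ[ℂ] Module.End ℂ W where
  toFun u := (f u).restrict (h u)
  map_add' u v := by ext w; simp
  map_smul' a u := by ext w; simp

@[simp] theorem coe_restrictMode {X M : Type*} [AddCommGroup X] [Module ℂ X] [AddCommGroup M]
    [Module ℂ M] (f : X →ₗ[ℂ] Module.End ℂ M) (W : Submodule ℂ M)
    (h : ∀ u, ∀ w ∈ W, f u w ∈ W) (u : X) (w : W) : (restrictMode f W h u w : M) = f u w := rfl

theorem fixed_closed (g : A.aut) (n : ℤ) (u : eigen g 0) (v : V) (hv : v ∈ eigen g 0) :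
    (A.mode n).domRestrict (eigen g 0) u v ∈ eigen g 0 := by
  rw [mem_eigen_zero] at hv ⊢
  have hu := (mem_eigen_zero g _).1 u.2
  rw [LinearMap.domRestrict_apply, g.2.2.2, hu, hv]

/-- The fixed-point subspace `V^0 = V^g` with its structure of a vertex operator algebra. -/
def fixed (g : A.aut) : VertexOperatorAlgebra (eigen g 0) where
  wt n := (A.wt n).comap (eigen g 0).subtype
  isInternal := isInternal_comap A.isInternal (c := fun n : ℤ => (n : ℂ)) Int.cast_injective
    (T := A.mode 1 A.omega) A.L_zero _
    (fun x hx => fixed_closed g 1 ⟨A.omega, (mem_eigen_zero g _).2 g.2.2.1⟩ x hx)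
  finiteDimensional n := by
    have := A.finiteDimensional n
    exact finiteDimensional_comap _ _
  bounded := by
    obtain ⟨n₀, h⟩ := A.bounded
    exact ⟨n₀, fun n hn => comap_subtype_eq_bot _ (h n hn)⟩
  mode n := restrictMode ((A.mode n).domRestrict (eigen g 0)) (eigen g 0) (fixed_closed g n)
  vacuum := ⟨A.vacuum, (mem_eigen_zero g _).2 g.2.1⟩
  omega := ⟨A.omega, (mem_eigen_zero g _).2 g.2.2.1⟩
  rank := A.rank
  truncation u v := by
    obtain ⟨n₀, h⟩ := A.truncation u v
    exact ⟨n₀, fun n hn => Subtype.ext (h n hn)⟩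
  vacuum_mem := A.vacuum_mem
  omega_mem := A.omega_mem
  mode_vacuum n v := by
    apply Subtype.ext
    rw [apply_ite Subtype.val]
    exact A.mode_vacuum n v
  creation_nonneg v n hn := Subtype.ext (A.creation_nonneg v n hn)
  creation v := Subtype.ext (A.creation v)
  jacobi u v w p s t := by
    apply Subtype.ext
    have h := A.jacobi u v w p s t
    have e : ∀ f : ℕ → eigen g 0, ((∑ᶠ m, f m : eigen g 0) : V) = ∑ᶠ m, (f m : V) := fun f =>
      AddMonoidHom.map_finsum_of_injective (eigen g 0).subtype.toAddMonoidHom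
        Subtype.val_injective f
    rw [e, e]
    exact h
  virasoro m n w := Subtype.ext (A.virasoro m n w)
  L_zero n v hv := Subtype.ext (A.L_zero n v hv)
  L_neg_one v n := by
    ext w
    exact congrArg (fun f => f (w : V)) (A.L_neg_one v n)

end VertexOperatorAlgebra

open VertexOperatorAlgebra

/-- A `g`-twisted `V`-module structure on `M`, for an automorphism `g` of finite order `K`.
The vertex operator of `v ∈ V` is `Y_M(v,z) = ∑_{n ∈ ℚ} v_n z^{-n-1}`, with `v_n = mode n v`; the
graded pieces are `M_lam = wt lam`. Residue classes modulo `K` are represented by integers. -/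
structure TwistedModule {V : Type*} [AddCommGroup V] [Module ℂ V] (A : VertexOperatorAlgebra V)
    (g : A.aut) (M : Type*) [AddCommGroup M] [Module ℂ M] where
  wt : ℂ → Submodule ℂ M
  isInternal : DirectSum.IsInternal wt
  finiteDimensional : ∀ lam, FiniteDimensional ℂ (wt lam)
  bounded : ∀ lam : ℂ, ∃ n₀ : ℤ, ∀ n ≤ n₀, wt (n + lam) = ⊥
  mode : ℚ → V →ₗ[ℂ] Module.End ℂ M
  /-- If `v ∈ V^r`, only the powers `z^{-n-1}` with `n ∈ r/K + ℤ` occur in `Y_M(v,z)`. -/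
  mode_eq_zero : ∀ (r : ℤ), ∀ v ∈ eigen g r, ∀ n : ℚ,
    (¬ ∃ k : ℤ, n = r / (orderOf g : ℚ) + k) → mode n v = 0
  truncation : ∀ (v : V) (w : M), ∃ n₀ : ℚ, ∀ n ≥ n₀, mode n v w = 0
  /-- `Y_M(𝟏,z) = 1`. -/
  mode_vacuum : ∀ (n : ℚ) (w : M), mode n A.vacuum w = if n = -1 then w else 0
  /-- The twisted Jacobi identity for `u ∈ V^r`: the coefficients of
  `z₀^{-p-1} z₁^{-s-1} z₂^{-t-1}` agree, where `p ∈ ℤ` and `s ∈ r/K + ℤ` (both sides have no other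
  powers of `z₀` and `z₁`). By `truncation` all the sums are finite. -/
  jacobi : ∀ (r : ℤ), ∀ u ∈ eigen g r, ∀ (v : V) (w : M) (p : ℤ) (s t : ℚ),
    (∃ k : ℤ, s = r / (orderOf g : ℚ) + k) →
    ∑ᶠ m : ℕ, ((-1 : ℂ) ^ m * Ring.choose (p : ℂ) m) •
        (mode (p + s - m) u (mode (t + m) v w)
          - (-1 : ℂ) ^ p • mode (p + t - m) v (mode (s + m) u w))
      = ∑ᶠ m : ℕ, Ring.choose (s : ℂ) m • mode (s + t - m) (A.mode (p + m) u v) w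
  /-- The Virasoro relations for `L(n) = ω_{n+1}`. -/
  virasoro : ∀ (m n : ℤ) (w : M),
    mode (m + 1) A.omega (mode (n + 1) A.omega w) - mode (n + 1) A.omega (mode (m + 1) A.omega w)
      = ((m : ℂ) - n) • mode (m + n + 1) A.omega w
        + (if m + n = 0 then ((m : ℂ) ^ 3 - m) / 12 * A.rank else 0) • w
  /-- `L(0)` acts on `M_lam` as the scalar `lam`. -/
  L_zero : ∀ (lam : ℂ), ∀ w ∈ wt lam, mode 1 A.omega w = lam • w
  /-- `d/dz Y_M(v,z) = Y_M(L(-1)v,z)`. -/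
  L_neg_one : ∀ (v : V) (n : ℚ), mode n (A.mode 0 A.omega v) = (-(n : ℂ)) • mode (n - 1) v

namespace TwistedModule

variable {V : Type*} [AddCommGroup V] [Module ℂ V] {A : VertexOperatorAlgebra V} {g : A.aut}
  {M N : Type*} [AddCommGroup M] [Module ℂ M] [AddCommGroup N] [Module ℂ N]

/-- Submodules: subspaces that are invariant under all `v_n`. -/
def IsSubmodule (S : TwistedModule A g M) (W : Submodule ℂ M) : Prop :=
  ∀ (n : ℚ) (v : V), ∀ w ∈ W, S.mode n v w ∈ W

/-- `M` is irreducible: it is nonzero, and its only submodules are `0` and `M`. -/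
def IsIrreducible (S : TwistedModule A g M) : Prop :=
  Nontrivial M ∧ ∀ W : Submodule ℂ M, S.IsSubmodule W → W = ⊥ ∨ W = ⊤

/-- `M ≅ N` as `g`-twisted `V`-modules: some linear isomorphism commutes with all `v_n`. -/
def IsIsomorphic (S : TwistedModule A g M) (T : TwistedModule A g N) : Prop :=
  ∃ φ : M ≃ₗ[ℂ] N, ∀ (n : ℚ) (v : V) (w : M), φ (S.mode n v w) = T.mode n v (φ w)

/-- The module structure on a submodule `W` of `M`. -/
def sub (S : TwistedModule A g M) (W : Submodule ℂ M) (hW : S.IsSubmodule W) :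
    TwistedModule A g W where
  wt lam := (S.wt lam).comap W.subtype
  isInternal := isInternal_comap S.isInternal (c := id) Function.injective_id
    (T := S.mode 1 A.omega) S.L_zero _ (hW 1 A.omega)
  finiteDimensional lam := by
    have := S.finiteDimensional lam
    exact finiteDimensional_comap _ _
  bounded lam := by
    obtain ⟨n₀, h⟩ := S.bounded lam
    exact ⟨n₀, fun n hn => comap_subtype_eq_bot _ (h n hn)⟩
  mode n := restrictMode (S.mode n) W (hW n)
  mode_eq_zero r v hv n hn := by
    ext w
    rw [coe_restrictMode, S.mode_eq_zero r v hv n hn]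
    rfl
  truncation v w := by
    obtain ⟨n₀, h⟩ := S.truncation v w
    exact ⟨n₀, fun n hn => Subtype.ext (h n hn)⟩
  mode_vacuum n w := by
    apply Subtype.ext
    rw [apply_ite Subtype.val]
    exact S.mode_vacuum n w
  jacobi r u hu v w p s t hs := by
    apply Subtype.ext
    have h := S.jacobi r u hu v w p s t hs
    have e : ∀ f : ℕ → W, ((∑ᶠ m, f m : W) : M) = ∑ᶠ m, (f m : M) := fun f =>
      AddMonoidHom.map_finsum_of_injective W.subtype.toAddMonoidHom Subtype.val_injective f
    rw [e, e]
    exact h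
  virasoro m n w := Subtype.ext (S.virasoro m n w)
  L_zero lam w hw := Subtype.ext (S.L_zero lam w hw)
  L_neg_one v n := by
    ext w
    exact congrArg (fun f => f (w : M)) (S.L_neg_one v n)

/-- The restriction of a `g`-twisted `V`-module to `V^0`: an untwisted `V^0`-module. -/
def res (S : TwistedModule A g M) : TwistedModule (fixed g) 1 M where
  wt := S.wt
  isInternal := S.isInternal
  finiteDimensional := S.finiteDimensional
  bounded := S.bounded
  mode n := (S.mode n).domRestrict (eigen g 0)
  mode_eq_zero r v _ n hn := by
    rw [LinearMap.domRestrict_apply]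
    refine S.mode_eq_zero 0 v v.2 n ?_
    rintro ⟨k, hk⟩
    refine hn ⟨k - r, ?_⟩
    rw [orderOf_one, hk]
    push_cast
    ring
  truncation v w := S.truncation v w
  mode_vacuum n w := S.mode_vacuum n w
  jacobi r u _ v w p s t hs := by
    refine S.jacobi 0 u u.2 v w p s t ?_
    obtain ⟨k, hk⟩ := hs
    refine ⟨r + k, ?_⟩
    rw [orderOf_one] at hk
    rw [hk]
    push_cast
    ring
  virasoro m n w := S.virasoro m n w
  L_zero lam w hw := S.L_zero lam w hw
  L_neg_one v n := S.L_neg_one v n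

theorem mode_mem_wt (S : TwistedModule A g M) (k : ℤ) (v : V) (hv : v ∈ A.wt k) (n : ℚ) (lam : ℂ)
    (w : M) (hw : w ∈ S.wt lam) : S.mode n v w ∈ S.wt (lam + k - n - 1) := by
  refine mem_wt_of_eigen S.isInternal (c := id) Function.injective_id (T := S.mode 1 A.omega)
    S.L_zero _ _ ?_
  have h := S.jacobi 0 A.omega ((mem_eigen_zero g _).2 g.2.2.1) v w 0 1 n ⟨1, by simp⟩
  rw [finsum_eq_single _ 0 (fun m hm => by
      rw [Int.cast_zero, Ring.choose_zero_pos ℂ (Nat.pos_of_ne_zero hm), mul_zero, zero_smul]),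
    finsum_eq_sum_of_support_subset (s := {0, 1}) _ (fun m hm => by
      by_contra hm'
      apply hm
      have h2 : 1 < m := by
        simp at hm'
        omega
      have h3 : Ring.choose (((1 : ℚ) : ℂ)) m = 0 := by
        rw [Rat.cast_one, ← Nat.cast_one, Ring.choose_natCast, Nat.choose_eq_zero_of_lt h2]
        simp
      exact (congrArg (fun a => a • _) h3).trans (zero_smul _ _))] at h
  have e : (1 : ℚ) + n - 1 = n := by ring
  simp [A.L_zero k v hv, S.L_neg_one, S.L_zero lam w hw, e] at h
  rw [sub_eq_iff_eq_add] at h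
  rw [h]
  simp only [id]
  module

/-- `lam ≤ mu` for complex numbers: `0 ≤ mu - lam ∈ (1/K)ℤ`, with `K` the order of `g`. -/
def WeightLE (g : A.aut) (lam mu : ℂ) : Prop :=
  ∃ n : ℕ, mu - lam = n / (orderOf g : ℂ)

/-- Minimal (lowest) weights of `M`. An irreducible `M` has exactly one. -/
def IsMinimalWeight (S : TwistedModule A g M) (lam : ℂ) : Prop :=
  S.wt lam ≠ ⊥ ∧ ∀ mu, S.wt mu ≠ ⊥ → WeightLE g mu lam → mu = lam

/-- The subspace `M^r = ⨁_{n ∈ ℤ} M_{lam - r/K + n}`, where `lam` is the minimal weight. It depends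
only on `r` modulo `K`, and the minimal weight space lies in `M^0`. -/
def componentSpace (S : TwistedModule A g M) (r : ℤ) : Submodule ℂ M :=
  ⨆ mu ∈ {mu : ℂ | ∃ lam, S.IsMinimalWeight lam ∧
    ∃ n : ℤ, mu = lam - r / (orderOf g : ℂ) + n}, S.wt mu

theorem componentSpace_isSubmodule (S : TwistedModule A g M) (r : ℤ) :
    S.res.IsSubmodule (S.componentSpace r) := by
  intro n v w hw
  have hint : ∀ (n : ℤ) (v : eigen g 0), ∀ w ∈ S.componentSpace r,
      S.res.mode n v w ∈ S.componentSpace r := by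
    intro n v w hw
    obtain ⟨s, y, hy, rfl⟩ := exists_decomp (fixed g).isInternal v
    rw [map_sum, LinearMap.sum_apply]
    refine Submodule.sum_mem _ fun k _ => ?_
    have hle : S.componentSpace r ≤ (S.componentSpace r).comap (S.res.mode n (y k)) := by
      refine iSup₂_le fun mu hmu x hx => ?_
      have hx' := S.res.mode_mem_wt k (y k) (hy k) n mu x hx
      obtain ⟨lam, hl, j, rfl⟩ := hmu
      refine Submodule.mem_iSup_of_mem _ (Submodule.mem_iSup_of_mem ⟨lam, hl, j + k - n - 1, ?_⟩ hx')
      push_cast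
      ring
    exact hle hw
  by_cases hn : ∃ k : ℤ, n = k
  · obtain ⟨k, rfl⟩ := hn
    exact hint k v w hw
  · have h0 := S.res.mode_eq_zero 0 v ((mem_eigen_zero _ _).2 rfl) n (by
      rintro ⟨k, hk⟩
      exact hn ⟨k, by simpa using hk⟩)
    rw [h0]
    exact zero_mem _

/-- The `V^0`-component `M^r` of a `g`-twisted `V`-module `M`, as an (untwisted) `V^0`-module. -/
def component (S : TwistedModule A g M) (r : ℤ) :
    TwistedModule (fixed g) 1 (S.componentSpace r) :=
  S.res.sub (S.componentSpace r) (S.componentSpace_isSubmodule r)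

end TwistedModule

end

/-!
The isomorphism `φ : M^r ≅ N^s` of `V^0`-modules is extended by looking at its graph inside `M × N`.
Let `W ⊆ M × N` be the subspace spanned by all `v_n (x, φ x)` with `v ∈ V` and `x ∈ M^r`.

* `W` is invariant under all modes. By weak associativity, i.e. the twisted Jacobi identity with
  exponent `s` so large that its second term vanishes, a product `u_q v_t` applied to a vector is a
  combination of single modes applied to it (`IsWeaklyAssociative.mode_mode_mem`).
* `W` meets `M^r × N^s` in the graph of `φ` only. The operators from `V^0` preserve the graph, since
  `φ` commutes with them, while those from `V^t`, `t ≢ 0` modulo `K`, map `M^r × N^s` to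
  `M^{r+t} × N^{s+t}`, which is independent of it: an irreducible module has a single minimal weight
  (`TwistedModule.IsMinimalWeight.eq`), so its components involve disjoint sets of weights.
* `M^r` and `N^s` are nonzero (`TwistedModule.componentSpace_ne_bot`). For nonzero `w`, the `u ∈ V`
  with `Y(u,z)w = 0` form an ideal, again by weak associativity, which is zero because `V` is simple
  (`IsWeaklyAssociative.exists_mode_ne_zero`). Hence the `r` with `V^r ≠ 0` form a subgroup, which
  is everything as `g` has order exactly `K`; and `V^r` maps the minimal weight space nontrivially
  into `M^r`.

So `W` projects nontrivially to `M` and to `N` and contains neither of them, and by irreducibility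
it is the graph of an isomorphism (`TwistedModule.isIsomorphic_of_prod_submodule`).
-/

noncomputable section

/-! ### The eigenspaces of an automorphism of finite order -/

open VertexOperatorAlgebra

namespace VertexOperatorAlgebra

variable {V : Type*} [AddCommGroup V] [Module ℂ V] {A : VertexOperatorAlgebra V} {g : A.aut}

theorem mode_mem_eigen {a b : ℤ} {u v : V} (hu : u ∈ eigen g a) (hv : v ∈ eigen g b) (n : ℤ) :
    A.mode n u v ∈ eigen g (a + b) := by
  rw [eigen, Module.End.mem_eigenspace_iff] at *
  change g.1 u = _ at hu
  change g.1 v = _ at hv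
  change g.1 (A.mode n u v) = _
  rw [g.2.2.2, hu, hv, map_smul, map_smul, LinearMap.smul_apply, smul_smul, ← Complex.exp_add]
  congr 2
  push_cast
  ring

theorem omega_mem_eigen : A.omega ∈ eigen g 0 := (mem_eigen_zero g _).2 g.2.2.1

theorem vacuum_mem_eigen : A.vacuum ∈ eigen g 0 := (mem_eigen_zero g _).2 g.2.1

/-- As `L(0)` preserves `V^r`, the space `V^r` is spanned by its homogeneous vectors. -/
theorem eigen_le_of_homogeneous {r : ℤ} {P : Submodule ℂ V}
    (h : ∀ (k : ℤ), ∀ v ∈ A.wt k, v ∈ eigen g r → v ∈ P) : eigen g r ≤ P := by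
  intro v hv
  obtain ⟨s, y, hy, rfl⟩ := exists_decomp A.isInternal v
  have hW : ∀ x ∈ eigen g r, A.mode 1 A.omega x ∈ eigen g r := fun x hx => by
    simpa using mode_mem_eigen omega_mem_eigen hx 1
  exact P.sum_mem fun i hi => h i _ (hy i)
    (mem_of_sum_mem (c := fun n : ℤ => (n : ℂ)) A.L_zero Int.cast_injective hW s y hy hv i hi)

theorem zeta_primitive (hg : IsOfFinOrder g) :
    IsPrimitiveRoot (Complex.exp (2 * Real.pi * Complex.I / (orderOf g : ℂ))) (orderOf g) :=
  Complex.isPrimitiveRoot_exp _ hg.orderOf_pos.ne'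

theorem exp_eq_zeta_zpow (r : ℤ) :
    Complex.exp (2 * Real.pi * Complex.I * r / (orderOf g : ℂ)) =
      Complex.exp (2 * Real.pi * Complex.I / (orderOf g : ℂ)) ^ r := by
  rw [← Complex.exp_int_mul]
  congr 1
  ring

theorem eigen_congr (hg : IsOfFinOrder g) {a b : ℤ} (hab : (orderOf g : ℤ) ∣ a - b) :
    eigen g a = eigen g b := by
  rw [eigen, eigen, exp_eq_zeta_zpow, exp_eq_zeta_zpow]
  congr 1
  rw [← sub_add_cancel a b, zpow_add₀ (Complex.exp_ne_zero _),
    ((zeta_primitive hg).zpow_eq_one_iff_dvd _).2 hab, one_mul]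

theorem coe_aut_pow (n : ℕ) (v : V) :
    ((g ^ n : A.aut).1 : V ≃ₗ[ℂ] V) v = ((g.1 : V →ₗ[ℂ] V) ^ n) v := by
  induction n generalizing v with
  | zero => rfl
  | succ n ih => rw [pow_succ, pow_succ, Module.End.mul_apply, ← ih]; rfl

theorem aut_pow_orderOf : ((g.1 : V →ₗ[ℂ] V) ^ orderOf g) = 1 := by
  ext v
  rw [← coe_aut_pow, pow_orderOf_eq_one]
  rfl

/-- An automorphism of finite order is diagonalizable: `V` is spanned by the spaces `V^r`. The
component of `v` in `V^r` is `K⁻¹ ∑_j ζ^{-rj} g^j v`. -/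
theorem eq_top_of_eigen_le (hg : IsOfFinOrder g) {P : Submodule ℂ V}
    (h : ∀ r : ℤ, eigen g r ≤ P) : P = ⊤ := by
  rw [eq_top_iff]
  rintro v -
  have hK := hg.orderOf_pos
  have hζ := zeta_primitive hg
  have hexp := exp_eq_zeta_zpow (g := g)
  set ζ := Complex.exp (2 * Real.pi * Complex.I / (orderOf g : ℂ)) with hζd
  set K := orderOf g with hKd
  have hζ0 : ζ ≠ 0 := Complex.exp_ne_zero _
  let G : Module.End ℂ V := (g.1 : V →ₗ[ℂ] V)
  have hG : G ^ K = 1 := aut_pow_orderOf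
  let y : ℕ → V := fun t => (∑ j ∈ Finset.range K, ((ζ⁻¹ ^ t) • G) ^ j) v
  have hy : ∀ t, y t ∈ P := by
    intro t
    refine h t ?_
    rw [eigen, Module.End.mem_eigenspace_iff, hexp]
    change G (y t) = _
    have h1 := mul_geom_sum ((ζ⁻¹ ^ t) • G) K
    rw [smul_pow, hG, ← pow_mul, mul_comm t K, pow_mul, inv_pow ζ K, hζ.pow_eq_one, inv_one, one_pow,
      one_smul, sub_self, sub_mul, one_mul, sub_eq_zero] at h1
    have h2 := congrArg (fun f : Module.End ℂ V => f v) h1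
    simp only [Module.End.mul_apply, LinearMap.smul_apply] at h2
    change ζ⁻¹ ^ t • G (y t) = y t at h2
    conv_rhs => rw [← h2]
    rw [smul_smul, zpow_natCast, inv_pow, mul_inv_cancel₀ (pow_ne_zero _ hζ0), one_smul]
  have hsum : ∑ t ∈ Finset.range K, y t = (K : ℂ) • v := by
    simp only [y, smul_pow, LinearMap.sum_apply, LinearMap.smul_apply]
    rw [Finset.sum_comm, Finset.sum_eq_single_of_mem 0 (Finset.mem_range.2 hK)]
    · simp [Nat.cast_smul_eq_nsmul]
    · intro j hj hj0
      rw [← Finset.sum_smul]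
      have hz : ∑ t ∈ Finset.range K, (ζ⁻¹ ^ t) ^ j = 0 := by
        have h1 : ζ⁻¹ ^ j - 1 ≠ 0 := by
          rw [sub_ne_zero, inv_pow, ne_eq, inv_eq_one]
          exact hζ.pow_ne_one_of_pos_of_lt hj0 (Finset.mem_range.1 hj)
        have h2 := mul_geom_sum (ζ⁻¹ ^ j) K
        rw [← pow_mul, mul_comm j K, pow_mul, inv_pow ζ K, hζ.pow_eq_one, inv_one, one_pow,
          sub_self] at h2
        rw [← (mul_eq_zero.1 h2).resolve_left h1]
        exact Finset.sum_congr rfl fun t _ => by rw [← pow_mul, ← pow_mul, mul_comm]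
      rw [hz, zero_smul]
  have hv : (K : ℂ) • v ∈ P := hsum ▸ P.sum_mem fun t _ => hy t
  exact (P.smul_mem_iff (Nat.cast_ne_zero.2 hK.ne')).1 hv

/-- The eigenvalues of `g` generate the group of all `K`-th roots of unity; since they form a group
as soon as `V^a`, `V^b ≠ 0` forces `V^{a+b} ≠ 0`, all of them occur. -/
theorem eigen_ne_bot (hg : IsOfFinOrder g) (h0 : eigen g 0 ≠ ⊥)
    (hadd : ∀ a b, eigen g a ≠ ⊥ → eigen g b ≠ ⊥ → eigen g (a + b) ≠ ⊥) (r : ℤ) :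
    eigen g r ≠ ⊥ := by
  have hK := hg.orderOf_pos
  have hζ := zeta_primitive hg
  have hexp := exp_eq_zeta_zpow (g := g)
  set ζ := Complex.exp (2 * Real.pi * Complex.I / (orderOf g : ℂ)) with hζd
  have hnsmul : ∀ a, eigen g a ≠ ⊥ → ∀ n : ℕ, eigen g (n * a) ≠ ⊥ := by
    intro a ha n
    induction n with
    | zero => simpa using h0
    | succ n ih => rw [Nat.cast_succ, add_mul, one_mul]; exact hadd _ _ ih ha
  let H : AddSubgroup ℤ :=
    { carrier := {a | eigen g a ≠ ⊥}
      add_mem' := fun {a b} ha hb => hadd a b ha hb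
      zero_mem' := h0
      neg_mem' := by
        intro a ha
        have := hnsmul a ha (orderOf g - 1)
        rwa [eigen_congr hg (b := -a) ⟨a, by rw [Nat.cast_sub hK]; push_cast; ring⟩] at this }
  obtain ⟨d, hd⟩ := Int.subgroup_cyclic H
  have hKH : ((orderOf g : ℕ) : ℤ) ∈ H := by
    change eigen g _ ≠ ⊥
    rwa [eigen_congr hg (b := 0) (by simp)]
  rw [hd, AddSubgroup.mem_closure_singleton] at hKH
  obtain ⟨e, he⟩ := hKH
  -- with `H = dℤ` and `K = e d`, the power `g ^ |e|` is the identity on each nonzero `V^a`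
  have hge : g ^ e.natAbs = 1 := by
    have htop := eq_top_of_eigen_le hg
      (P := LinearMap.eqLocus ((g.1 : V →ₗ[ℂ] V) ^ e.natAbs) LinearMap.id) (by
        intro a v hv
        rw [LinearMap.mem_eqLocus, LinearMap.id_apply]
        by_cases hbot : eigen g a = ⊥
        · rw [hbot, Submodule.mem_bot] at hv
          rw [hv, map_zero]
        have haH : a ∈ H := hbot
        rw [hd, AddSubgroup.mem_closure_singleton] at haH
        obtain ⟨f, hf⟩ := haH
        rw [eigen, hexp] at hv
        have hpow : ∀ n : ℕ, ((g.1 : V →ₗ[ℂ] V) ^ n) v = ((ζ ^ a) ^ n) • v := by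
          intro n
          induction n with
          | zero => simp
          | succ n ih =>
            rw [pow_succ', Module.End.mul_apply, ih, map_smul,
              Module.End.mem_eigenspace_iff.1 hv, smul_smul, pow_succ]
        have hdvd : (orderOf g : ℤ) ∣ a * (e.natAbs : ℤ) := by
          rw [← hf, ← he, smul_eq_mul, smul_eq_mul, mul_comm f d, mul_assoc, mul_comm d]
          exact mul_dvd_mul_right (Dvd.dvd.mul_left (Int.dvd_natAbs.2 dvd_rfl) f) d
        rw [hpow, ← zpow_natCast, ← zpow_mul, (hζ.zpow_eq_one_iff_dvd _).2 hdvd, one_smul])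
    apply Subtype.ext
    apply LinearEquiv.ext
    intro v
    rw [coe_aut_pow]
    exact (htop ▸ Submodule.mem_top : v ∈ LinearMap.eqLocus _ _)
  have hd1 : d.natAbs = 1 := by
    have h1 := congrArg Int.natAbs he
    rw [smul_eq_mul, Int.natAbs_mul, Int.natAbs_natCast] at h1
    have he0 : 0 < e.natAbs := Nat.pos_of_ne_zero fun h => by
      rw [h, zero_mul] at h1
      omega
    have h2 := Nat.le_of_dvd he0 (orderOf_dvd_of_pow_eq_one hge)
    rw [← h1] at h2 hK
    exact le_antisymm (Nat.le_of_mul_le_mul_left (by simpa using h2) he0)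
      (Nat.pos_of_mul_pos_left hK)
  have hr : r ∈ H := by
    rw [hd, AddSubgroup.mem_closure_singleton]
    exact ⟨r * d, by rcases Int.natAbs_eq d with h | h <;> rw [h, hd1] <;> simp⟩
  exact hr

end VertexOperatorAlgebra

/-! ### Weak associativity and generated submodules -/

/-- The part of the axioms of a twisted module that governs generated submodules: modes `v_n` with
exponents in the right residue classes, truncation, `Y(𝟏,z) = 1`, and the case of the twisted Jacobi
identity in which `s` is so large that `u_{s+m} w = 0` for all `m ≥ 0`. In the last field both sums
are finite, hence independent of the upper end `n` once it is large. Unlike `TwistedModule`, it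
passes to products without any bookkeeping about weights. -/
structure IsWeaklyAssociative {V : Type*} [AddCommGroup V] [Module ℂ V]
    (A : VertexOperatorAlgebra V) (g : A.aut) {M : Type*} [AddCommGroup M] [Module ℂ M]
    (Y : ℚ → V →ₗ[ℂ] Module.End ℂ M) : Prop where
  mode_eq_zero : ∀ (r : ℤ), ∀ v ∈ eigen g r, ∀ n : ℚ,
    (¬ ∃ k : ℤ, n = r / (orderOf g : ℚ) + k) → Y n v = 0
  truncation : ∀ (v : V) (w : M), ∃ n₀ : ℚ, ∀ n ≥ n₀, Y n v w = 0
  mode_vacuum : ∀ w : M, Y (-1) A.vacuum w = w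
  assoc : ∀ (r : ℤ), ∀ u ∈ eigen g r, ∀ (v : V) (w : M), ∃ s₀ : ℚ, ∀ s ≥ s₀,
    (∃ k : ℤ, s = r / (orderOf g : ℚ) + k) → ∀ (p : ℤ) (t : ℚ), ∃ n₀ : ℕ, ∀ n ≥ n₀,
      ∑ m ∈ Finset.range n, ((-1 : ℂ) ^ m * Ring.choose (p : ℂ) m) •
          Y (p + s - m) u (Y (t + m) v w)
        = ∑ m ∈ Finset.range n, Ring.choose (s : ℂ) m • Y (s + t - m) (A.mode (p + m) u v) w

theorem TwistedModule.isWeaklyAssociative {V : Type*} [AddCommGroup V] [Module ℂ V]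
    {A : VertexOperatorAlgebra V} {g : A.aut} {M : Type*} [AddCommGroup M] [Module ℂ M]
    (S : TwistedModule A g M) : IsWeaklyAssociative A g S.mode where
  mode_eq_zero := S.mode_eq_zero
  truncation := S.truncation
  mode_vacuum w := by simpa using S.mode_vacuum (-1) w
  assoc r u hu v w := by
    obtain ⟨s₀, hs₀⟩ := S.truncation u w
    refine ⟨s₀, fun s hs hsk p t => ?_⟩
    obtain ⟨t₀, ht₀⟩ := S.truncation v w
    obtain ⟨p₀, hp₀⟩ := A.truncation u v
    refine ⟨max ⌈t₀ - t⌉₊ (p₀ - p).toNat, fun n hn => ?_⟩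
    have h := S.jacobi r u hu v w p s t hsk
    have hz : ∀ m : ℕ, S.mode (s + m) u w = 0 := fun m =>
      hs₀ _ (le_add_of_le_of_nonneg hs (Nat.cast_nonneg m))
    simp only [hz, map_zero, smul_zero, sub_zero] at h
    rw [finsum_eq_sum_of_support_subset (s := Finset.range n) _ ?_,
      finsum_eq_sum_of_support_subset (s := Finset.range n) _ ?_] at h
    · exact h
    · intro m hm
      by_contra hmn
      rw [Finset.coe_range, Set.mem_Iio, not_lt] at hmn
      refine hm ?_
      have : p₀ ≤ p + m := by
        have := (le_max_right _ _).trans (hn.le.trans hmn)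
        omega
      simp [hp₀ _ this]
    · intro m hm
      by_contra hmn
      rw [Finset.coe_range, Set.mem_Iio, not_lt] at hmn
      refine hm ?_
      have : t₀ ≤ t + m := by
        have := Nat.ceil_le.1 ((le_max_left _ _).trans (hn.le.trans hmn))
        linarith
      simp [ht₀ _ this]

namespace IsWeaklyAssociative

variable {V : Type*} [AddCommGroup V] [Module ℂ V] {A : VertexOperatorAlgebra V} {g : A.aut}
  {M N : Type*} [AddCommGroup M] [Module ℂ M] [AddCommGroup N] [Module ℂ N]

/-- The diagonal action of the modes on `M × N`. -/
def prodMode (Y : ℚ → V →ₗ[ℂ] Module.End ℂ M) (Z : ℚ → V →ₗ[ℂ] Module.End ℂ N) (n : ℚ) :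
    V →ₗ[ℂ] Module.End ℂ (M × N) where
  toFun v := (Y n v).prodMap (Z n v)
  map_add' u v := by ext <;> simp
  map_smul' a u := by ext <;> simp

@[simp] theorem prodMode_apply (Y : ℚ → V →ₗ[ℂ] Module.End ℂ M) (Z : ℚ → V →ₗ[ℂ] Module.End ℂ N)
    (n : ℚ) (v : V) (w : M × N) : prodMode Y Z n v w = (Y n v w.1, Z n v w.2) := rfl

theorem prod {Y : ℚ → V →ₗ[ℂ] Module.End ℂ M} {Z : ℚ → V →ₗ[ℂ] Module.End ℂ N}
    (hY : IsWeaklyAssociative A g Y) (hZ : IsWeaklyAssociative A g Z) :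
    IsWeaklyAssociative A g (prodMode Y Z) where
  mode_eq_zero r v hv n hn := by
    ext w <;> simp [hY.mode_eq_zero r v hv n hn, hZ.mode_eq_zero r v hv n hn]
  truncation v w := by
    obtain ⟨a, ha⟩ := hY.truncation v w.1
    obtain ⟨b, hb⟩ := hZ.truncation v w.2
    exact ⟨max a b, fun n hn => Prod.ext (ha n ((le_max_left _ _).trans hn))
      (hb n ((le_max_right _ _).trans hn))⟩
  mode_vacuum w := Prod.ext (hY.mode_vacuum _) (hZ.mode_vacuum _)
  assoc r u hu v w := by
    obtain ⟨a, ha⟩ := hY.assoc r u hu v w.1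
    obtain ⟨b, hb⟩ := hZ.assoc r u hu v w.2
    refine ⟨max a b, fun s hs hsk p t => ?_⟩
    obtain ⟨c, hc⟩ := ha s ((le_max_left _ _).trans hs) hsk p t
    obtain ⟨d, hd⟩ := hb s ((le_max_right _ _).trans hs) hsk p t
    refine ⟨max c d, fun n hn => Prod.ext ?_ ?_⟩
    · simpa [Prod.fst_sum] using hc n ((le_max_left _ _).trans hn)
    · simpa [Prod.snd_sum] using hd n ((le_max_right _ _).trans hn)

variable {Y : ℚ → V →ₗ[ℂ] Module.End ℂ M}

theorem exists_exponent_ge (g : A.aut) (r : ℤ) (s₀ : ℚ) :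
    ∃ k : ℤ, s₀ ≤ r / (orderOf g : ℚ) + k :=
  ⟨⌈s₀ - r / (orderOf g : ℚ)⌉, by linarith [Int.le_ceil (s₀ - r / (orderOf g : ℚ))]⟩

/-- Products of two modes applied to `w` are combinations of single modes applied to `w`. Solving
weak associativity for the term with `m = 0` expresses `u_q v_t w` through single modes and
the vectors `u_{q-m} v_{t+m} w` with `m > 0`; so truncation permits downward induction on `t`. -/
theorem mode_mode_mem (hY : IsWeaklyAssociative A g Y) {a b : ℤ} {u v : V}
    (hu : u ∈ eigen g a) (hv : v ∈ eigen g b) (w : M) {P : Submodule ℂ M}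
    (hP : ∀ (n : ℚ), ∀ c ∈ eigen g (a + b), Y n c w ∈ P) (q t : ℚ) :
    Y q u (Y t v w) ∈ P := by
  obtain ⟨s₀, hs₀⟩ := hY.assoc a u hu v w
  obtain ⟨k, hk⟩ := exists_exponent_ge g a s₀
  obtain ⟨t₀, ht₀⟩ := hY.truncation v w
  have key : ∀ (d : ℕ) (q t : ℚ), t₀ - d ≤ t → Y q u (Y t v w) ∈ P := by
    intro d
    induction d with
    | zero =>
      intro q t ht
      rw [ht₀ t (by simpa using ht), map_zero]
      exact P.zero_mem
    | succ d ih =>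
      intro q t ht
      by_cases hq : ∃ j : ℤ, q = a / (orderOf g : ℚ) + j
      · obtain ⟨j, hj⟩ := hq
        obtain ⟨n₀, hn₀⟩ := hs₀ _ hk ⟨k, rfl⟩ (j - k) t
        have h := hn₀ (n₀ + 1) (Nat.le_succ _)
        rw [Finset.sum_range_succ'] at h
        have hR : ∑ m ∈ Finset.range (n₀ + 1),
            Ring.choose (((a / (orderOf g : ℚ) + k : ℚ)) : ℂ) m •
              Y (a / (orderOf g : ℚ) + k + t - m) (A.mode (j - k + m) u v) w ∈ P :=
          P.sum_mem fun m _ => P.smul_mem _ (hP _ _ (mode_mem_eigen hu hv _))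
        rw [← h] at hR
        have hL := (P.add_mem_iff_right (P.sum_mem fun m _ => P.smul_mem _
          (ih _ _ (by push_cast at ht ⊢; linarith [(Nat.cast_nonneg m : (0 : ℚ) ≤ m)])))).1 hR
        have e : ((j - k : ℤ) : ℚ) + (a / (orderOf g : ℚ) + k) - (0 : ℕ) = q := by
          rw [hj]; push_cast; ring
        rw [e, pow_zero, Ring.choose_zero_right, mul_one, one_smul, Nat.cast_zero, add_zero] at hL
        exact hL
      · rw [hY.mode_eq_zero a u hu q hq]
        exact P.zero_mem
  refine key ⌈t₀ - t⌉₊ q t ?_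
  linarith [Nat.le_ceil (t₀ - t)]

/-- The span of the vectors `v_n x` with `x ∈ X`. -/
def generate (Y : ℚ → V →ₗ[ℂ] Module.End ℂ M) (X : Submodule ℂ M) : Submodule ℂ M :=
  ⨆ (n : ℚ) (v : V), X.map (Y n v)

theorem mode_mem_generate {X : Submodule ℂ M} (n : ℚ) (v : V) {x : M} (hx : x ∈ X) :
    Y n v x ∈ generate Y X :=
  Submodule.mem_iSup_of_mem n (Submodule.mem_iSup_of_mem v (Submodule.mem_map_of_mem hx))

theorem le_generate (hY : IsWeaklyAssociative A g Y) (X : Submodule ℂ M) : X ≤ generate Y X :=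
  fun x hx => by
    rw [← hY.mode_vacuum x]
    exact mode_mem_generate _ _ hx

theorem generate_le (hg : IsOfFinOrder g) {X P : Submodule ℂ M}
    (h : ∀ (r : ℤ), ∀ v ∈ eigen g r, ∀ (n : ℚ), ∀ x ∈ X, Y n v x ∈ P) : generate Y X ≤ P := by
  refine iSup₂_le fun n v => ?_
  rintro _ ⟨x, hx, rfl⟩
  have htop := eq_top_of_eigen_le hg (P := P.comap ((Y n).flip x)) fun r v hv => h r v hv n x hx
  exact (htop ▸ Submodule.mem_top : v ∈ P.comap ((Y n).flip x))

theorem mode_generate_mem (hY : IsWeaklyAssociative A g Y) (hg : IsOfFinOrder g)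
    (X : Submodule ℂ M) (n : ℚ) (u : V) {w : M} (hw : w ∈ generate Y X) :
    Y n u w ∈ generate Y X := by
  have htop := eq_top_of_eigen_le hg (P := (generate Y X).comap ((Y n).flip w)) fun a u hu => by
    have hle : generate Y X ≤ (generate Y X).comap (Y n u) :=
      generate_le hg fun b v hv m x hx =>
        hY.mode_mode_mem hu hv x (fun k c _ => mode_mem_generate k c hx) n m
    exact hle hw
  exact (htop ▸ Submodule.mem_top : u ∈ (generate Y X).comap ((Y n).flip w))

/-- If `V` is simple, then `u` and `w` nonzero imply `Y(u,z)w ≠ 0`: the `u` with `Y(u,z)w = 0` form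
an ideal, by weak associativity, and this ideal does not contain `𝟏`. -/
theorem exists_mode_ne_zero (hY : IsWeaklyAssociative A g Y) (hg : IsOfFinOrder g)
    (hA : A.IsSimple) {u : V} (hu : u ≠ 0) {w : M} (hw : w ≠ 0) : ∃ n, Y n u w ≠ 0 := by
  let I : Submodule ℂ V := ⨅ n, LinearMap.ker ((Y n).flip w)
  have hmem : ∀ v, v ∈ I ↔ ∀ n, Y n v w = 0 := fun v => by simp [I]
  have hI : ∀ (p : ℤ) (c : V), ∀ v ∈ I, A.mode p c v ∈ I := by
    intro p c v hv
    have htop := eq_top_of_eigen_le hg (P := I.comap ((A.mode p).flip v)) fun a c hc => by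
      obtain ⟨s₀, hs₀⟩ := hY.assoc a c hc v w
      obtain ⟨k, hk⟩ := exists_exponent_ge g a s₀
      obtain ⟨p₀, hp₀⟩ := A.truncation c v
      -- downward induction on `p`, the truncation of `Y(c,z)v` being the start
      have key : ∀ (d : ℕ) (p : ℤ), p₀ - d ≤ p → A.mode p c v ∈ I := by
        intro d
        induction d with
        | zero =>
          intro p hp
          rw [hp₀ p (by simpa using hp)]
          exact I.zero_mem
        | succ d ih =>
          intro p hp
          rw [hmem]
          intro n
          obtain ⟨n₀, hn₀⟩ := hs₀ _ hk ⟨k, rfl⟩ p (n - (a / (orderOf g : ℚ) + k))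
          have h := hn₀ (n₀ + 1) (Nat.le_succ _)
          rw [Finset.sum_eq_zero fun m _ => by rw [(hmem v).1 hv, map_zero, smul_zero],
            Finset.sum_range_succ', Finset.sum_eq_zero fun m _ => by
              rw [(hmem _).1 (ih (p + (m + 1 : ℕ)) (by push_cast at hp ⊢; omega)), smul_zero]] at h
          simpa [Ring.choose_zero_right] using h.symm
      exact key (p₀ - p).toNat p (by omega)
    exact (htop ▸ Submodule.mem_top : c ∈ I.comap ((A.mode p).flip v))
  by_contra! h
  rcases hA.2 I hI with hbot | htop
  · exact hu ((Submodule.mem_bot ℂ).1 (hbot ▸ (hmem u).2 h))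
  · have := (hmem A.vacuum).1 (htop ▸ Submodule.mem_top) (-1)
    rw [hY.mode_vacuum] at this
    exact hw this

/-- In the presence of a nonzero twisted module, every `V^r` is nonzero. -/
theorem eigen_ne_bot (hY : IsWeaklyAssociative A g Y) (hg : IsOfFinOrder g) (hA : A.IsSimple)
    [Nontrivial M] (r : ℤ) : eigen g r ≠ ⊥ := by
  obtain ⟨w, hw⟩ := exists_ne (0 : M)
  refine VertexOperatorAlgebra.eigen_ne_bot hg (fun h0 => hw ?_) (fun a b ha hb hab => ?_) r
  · have hvac : A.vacuum ∈ eigen g 0 := vacuum_mem_eigen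
    rw [h0, Submodule.mem_bot] at hvac
    rw [← hY.mode_vacuum w, hvac, map_zero, LinearMap.zero_apply]
  · obtain ⟨u, hu, hu0⟩ := Submodule.exists_mem_ne_zero_of_ne_bot ha
    obtain ⟨v, hv, hv0⟩ := Submodule.exists_mem_ne_zero_of_ne_bot hb
    obtain ⟨t, ht⟩ := hY.exists_mode_ne_zero hg hA hv0 hw
    obtain ⟨q, hq⟩ := hY.exists_mode_ne_zero hg hA hu0 ht
    refine hq ((Submodule.mem_bot ℂ).1 (hY.mode_mode_mem hu hv w (P := ⊥) (fun n c hc => ?_) q t))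
    rw [hab, Submodule.mem_bot] at hc
    rw [hc, map_zero, LinearMap.zero_apply]
    exact Submodule.zero_mem _

end IsWeaklyAssociative

/-! ### Weights, components and the isomorphism -/

namespace TwistedModule

variable {V : Type*} [AddCommGroup V] [Module ℂ V] {A : VertexOperatorAlgebra V} {g : A.aut}
  {M N : Type*} [AddCommGroup M] [Module ℂ M] [AddCommGroup N] [Module ℂ N]

/-- Modes of elements of `V^r` map `M_mu` into the sum of the `M_{mu - r/K + j}`, `j ∈ ℤ`. -/
theorem mode_mem_of_mem_wt (S : TwistedModule A g M) {r : ℤ} {v : V} (hv : v ∈ eigen g r)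
    {mu : ℂ} {x : M} (hx : x ∈ S.wt mu) {P : Submodule ℂ M}
    (hP : ∀ j : ℤ, S.wt (mu - r / (orderOf g : ℂ) + j) ≤ P) (n : ℚ) : S.mode n v x ∈ P := by
  by_cases hn : ∃ k : ℤ, n = r / (orderOf g : ℚ) + k
  · obtain ⟨k, hk⟩ := hn
    have hle : eigen g r ≤ P.comap ((S.mode n).flip x) := by
      refine eigen_le_of_homogeneous fun l u hu _ => ?_
      have h := S.mode_mem_wt l u hu n mu x hx
      have e : mu + l - n - 1 = mu - r / (orderOf g : ℂ) + ((l - k - 1 : ℤ) : ℂ) := by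
        rw [hk]
        push_cast
        ring
      exact hP _ (e ▸ h)
    exact hle hv
  · rw [S.mode_eq_zero r v hv n hn]
    exact P.zero_mem

theorem disjoint_iSup_wt (S : TwistedModule A g M) {s t : Set ℂ} (hst : Disjoint s t) :
    Disjoint (⨆ mu ∈ s, S.wt mu) (⨆ mu ∈ t, S.wt mu) :=
  S.isInternal.submodule_iSupIndep.disjoint_biSup_biSup hst

theorem generate_eq_top {S : TwistedModule A g M} (hS : S.IsIrreducible) (hg : IsOfFinOrder g)
    {X : Submodule ℂ M} (hX : X ≠ ⊥) : IsWeaklyAssociative.generate S.mode X = ⊤ :=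
  (hS.2 _ fun n v _ hw => S.isWeaklyAssociative.mode_generate_mem hg X n v hw).resolve_left
    fun h => hX (le_bot_iff.1 (h ▸ S.isWeaklyAssociative.le_generate X))

/-- The weights of an irreducible module lie in one coset of `(1/K)ℤ`, as the module is generated
by any nonzero weight vector. -/
theorem exists_weight_eq {S : TwistedModule A g M} (hS : S.IsIrreducible) (hg : IsOfFinOrder g)
    {mu nu : ℂ} (hmu : S.wt mu ≠ ⊥) (hnu : S.wt nu ≠ ⊥) :
    ∃ j : ℤ, nu = mu + j / (orderOf g : ℂ) := by
  by_contra hne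
  have hK : (orderOf g : ℂ) ≠ 0 := Nat.cast_ne_zero.2 hg.orderOf_pos.ne'
  have hle : IsWeaklyAssociative.generate S.mode (S.wt mu) ≤
      ⨆ ka ∈ {ka : ℂ | ∃ j : ℤ, ka = mu + j / (orderOf g : ℂ)}, S.wt ka := by
    refine IsWeaklyAssociative.generate_le hg fun r v hv n x hx => ?_
    refine S.mode_mem_of_mem_wt hv hx (fun j => ?_) n
    refine le_iSup₂_of_le (mu - r / (orderOf g : ℂ) + j) ⟨j * orderOf g - r, ?_⟩ le_rfl
    push_cast
    field_simp
    ring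
  rw [generate_eq_top hS hg hmu, top_le_iff] at hle
  have hdis := S.disjoint_iSup_wt (s := {nu})
    (t := {ka : ℂ | ∃ j : ℤ, ka = mu + j / (orderOf g : ℂ)}) (Set.disjoint_singleton_left.2 hne)
  rw [hle, disjoint_top] at hdis
  exact hnu (by simpa using hdis)

theorem exists_wt_ne_bot (S : TwistedModule A g M) [Nontrivial M] : ∃ mu, S.wt mu ≠ ⊥ := by
  by_contra! h
  have htop := S.isInternal.submodule_iSup_eq_top
  rw [iSup_congr h, iSup_bot] at htop
  exact bot_ne_top htop

theorem exists_isMinimalWeight {S : TwistedModule A g M} (hg : IsOfFinOrder g) [Nontrivial M] :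
    ∃ lam, S.IsMinimalWeight lam := by
  have hK := hg.orderOf_pos
  have hK0 : (orderOf g : ℂ) ≠ 0 := Nat.cast_ne_zero.2 hK.ne'
  obtain ⟨mu, hmu⟩ := S.exists_wt_ne_bot
  choose b hb using fun i : ℕ => S.bounded (mu + i / (orderOf g : ℂ))
  -- the lower bounds for the `K` classes modulo `ℤ` give one for the whole coset `mu + (1/K)ℤ`
  obtain ⟨B, hB⟩ : ∃ B : ℤ, ∀ i ∈ Finset.range (orderOf g), B ≤ b i := by
    obtain ⟨B, hB⟩ := ((Finset.range (orderOf g)).image b).bddBelow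
    exact ⟨B, fun i hi => hB (Finset.mem_coe.2 (Finset.mem_image_of_mem b hi))⟩
  obtain ⟨n, hn, hmin⟩ := Int.exists_least_of_bdd
    (P := fun n : ℤ => S.wt (mu + n / (orderOf g : ℂ)) ≠ ⊥)
    ⟨orderOf g * B, fun n hn => by
      by_contra! hlt
      have hq := Int.mul_ediv_add_emod n (orderOf g)
      have h0 := Int.emod_nonneg n (b := orderOf g) (by omega)
      have h1 := Int.emod_lt_of_pos n (b := orderOf g) (by omega)
      obtain ⟨i, hi⟩ := Int.eq_ofNat_of_zero_le h0
      rw [hi] at hq h1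
      have h2 : n / orderOf g ≤ B := by
        by_contra! hlt'
        have : (orderOf g : ℤ) * B ≤ orderOf g * (n / orderOf g) :=
          mul_le_mul_of_nonneg_left hlt'.le (by omega)
        omega
      refine hn ?_
      rw [← hb i _ (h2.trans (hB i (Finset.mem_range.2 (by exact_mod_cast h1))))]
      congr 1
      conv_lhs => rw [← hq]
      push_cast
      field_simp
      ring⟩ ⟨0, by simpa using hmu⟩
  refine ⟨_, hn, ?_⟩
  rintro nu hnu ⟨m, hm⟩
  have e : nu = mu + ((n - m : ℤ) : ℂ) / (orderOf g : ℂ) := by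
    rw [← sub_sub_self (mu + n / (orderOf g : ℂ)) nu, hm]
    push_cast
    ring
  have := hmin (n - m) (e ▸ hnu)
  have hm0 : m = 0 := by omega
  rw [e, hm0]
  simp

theorem IsMinimalWeight.eq {S : TwistedModule A g M} (hS : S.IsIrreducible) (hg : IsOfFinOrder g)
    {lam mu : ℂ} (hlam : S.IsMinimalWeight lam) (hmu : S.IsMinimalWeight mu) : lam = mu := by
  obtain ⟨j, hj⟩ := exists_weight_eq hS hg hlam.1 hmu.1
  rcases le_total 0 j with h | h
  · obtain ⟨m, rfl⟩ := Int.eq_ofNat_of_zero_le h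
    exact hmu.2 lam hlam.1 ⟨m, by rw [hj]; simp⟩
  · obtain ⟨m, hm⟩ := Int.eq_ofNat_of_zero_le (neg_nonneg.2 h)
    refine (hlam.2 mu hmu.1 ⟨m, ?_⟩).symm
    rw [hj, ← neg_neg j, hm]
    push_cast
    ring

/-- The set of weights `λ - r/K + n`, `n ∈ ℤ`, with `λ` minimal, whose weight spaces span `M^r`. -/
def componentWeights (S : TwistedModule A g M) (r : ℤ) : Set ℂ :=
  {mu : ℂ | ∃ lam, S.IsMinimalWeight lam ∧ ∃ n : ℤ, mu = lam - r / (orderOf g : ℂ) + n}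

/-- The sum of the weight spaces of `M` that do not occur in `M^r`. -/
def componentCompl (S : TwistedModule A g M) (r : ℤ) : Submodule ℂ M :=
  ⨆ mu ∈ (S.componentWeights r)ᶜ, S.wt mu

theorem disjoint_componentCompl (S : TwistedModule A g M) (r : ℤ) :
    Disjoint (S.componentSpace r) (S.componentCompl r) :=
  S.disjoint_iSup_wt disjoint_compl_right

theorem mode_mem_componentSpace (S : TwistedModule A g M) {r t : ℤ} {v : V} (hv : v ∈ eigen g t)
    {x : M} (hx : x ∈ S.componentSpace r) (n : ℚ) : S.mode n v x ∈ S.componentSpace (r + t) := by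
  have hle : S.componentSpace r ≤ (S.componentSpace (r + t)).comap (S.mode n v) := by
    refine iSup₂_le fun mu hmu x hx =>
      Submodule.mem_comap.2 (S.mode_mem_of_mem_wt hv hx (fun j => ?_) n)
    obtain ⟨lam, hl, i, rfl⟩ := hmu
    refine le_iSup₂_of_le _ ⟨lam, hl, i + j, ?_⟩ le_rfl
    push_cast
    ring
  exact hle hx

theorem componentSpace_add_le {S : TwistedModule A g M} (hS : S.IsIrreducible)
    (hg : IsOfFinOrder g) (r : ℤ) {t : ℤ} (ht : ¬ (orderOf g : ℤ) ∣ t) :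
    S.componentSpace (r + t) ≤ S.componentCompl r := by
  refine iSup₂_le fun mu hmu => le_iSup₂_of_le mu ?_ le_rfl
  rintro ⟨lam', hl', j, hj⟩
  obtain ⟨lam, hl, i, rfl⟩ := hmu
  obtain rfl := IsMinimalWeight.eq hS hg hl hl'
  have hK : (orderOf g : ℂ) ≠ 0 := Nat.cast_ne_zero.2 hg.orderOf_pos.ne'
  refine ht ⟨i - j, ?_⟩
  have h : (t : ℂ) = ((orderOf g : ℤ) * (i - j) : ℤ) := by
    push_cast at hj ⊢
    field_simp at hj
    linear_combination -hj
  exact_mod_cast h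

theorem componentSpace_ne_bot {S : TwistedModule A g M} (hS : S.IsIrreducible)
    (hg : IsOfFinOrder g) (hA : A.IsSimple) (r : ℤ) : S.componentSpace r ≠ ⊥ := by
  have := hS.1
  obtain ⟨lam, hl⟩ := exists_isMinimalWeight (S := S) hg
  obtain ⟨w, hw, hw0⟩ := Submodule.exists_mem_ne_zero_of_ne_bot hl.1
  have hwc : w ∈ S.componentSpace 0 :=
    (le_iSup₂_of_le (f := fun mu (_ : mu ∈ S.componentWeights 0) => S.wt mu) lam
      ⟨lam, hl, 0, by simp⟩ le_rfl) hw
  obtain ⟨v, hv, hv0⟩ :=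
    Submodule.exists_mem_ne_zero_of_ne_bot (S.isWeaklyAssociative.eigen_ne_bot hg hA r)
  obtain ⟨n, hn⟩ := S.isWeaklyAssociative.exists_mode_ne_zero hg hA hv0 hw0
  intro h
  have := S.mode_mem_componentSpace hv hwc n
  rw [zero_add, h, Submodule.mem_bot] at this
  exact hn this

/-- Goursat's lemma for irreducible modules: an invariant subspace of `M × N` that projects
nontrivially to both factors, and contains neither of them, is the graph of an isomorphism. -/
theorem isIsomorphic_of_prod_submodule {S : TwistedModule A g M} (hS : S.IsIrreducible)
    {T : TwistedModule A g N} (hT : T.IsIrreducible) (W : Submodule ℂ (M × N))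
    (hW : ∀ (n : ℚ) (v : V), ∀ w ∈ W, (S.mode n v w.1, T.mode n v w.2) ∈ W)
    (hfst : W.map (LinearMap.fst ℂ M N) ≠ ⊥) (hsnd : W.map (LinearMap.snd ℂ M N) ≠ ⊥)
    (hinl : W.comap (LinearMap.inl ℂ M N) ≠ ⊤) (hinr : W.comap (LinearMap.inr ℂ M N) ≠ ⊤) :
    S.IsIsomorphic T := by
  have hfst' := (hS.2 (W.map (LinearMap.fst ℂ M N)) (by
    rintro n v _ ⟨w, hw, rfl⟩
    exact ⟨_, hW n v w hw, rfl⟩)).resolve_left hfst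
  have hsnd' := (hT.2 (W.map (LinearMap.snd ℂ M N)) (by
    rintro n v _ ⟨w, hw, rfl⟩
    exact ⟨_, hW n v w hw, rfl⟩)).resolve_left hsnd
  have hinl' := (hS.2 (W.comap (LinearMap.inl ℂ M N)) (fun n v w hw => by
    simpa using hW n v _ hw)).resolve_right hinl
  have hinr' := (hT.2 (W.comap (LinearMap.inr ℂ M N)) (fun n v w hw => by
    simpa using hW n v _ hw)).resolve_right hinr
  let p : W →ₗ[ℂ] M := LinearMap.fst ℂ M N ∘ₗ W.subtype
  let q : W →ₗ[ℂ] N := LinearMap.snd ℂ M N ∘ₗ W.subtype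
  have hp : Function.Bijective p := by
    constructor
    · rw [injective_iff_map_eq_zero]
      rintro ⟨⟨x, y⟩, hw⟩ (rfl : x = 0)
      have hy : y ∈ W.comap (LinearMap.inr ℂ M N) := hw
      rw [hinr', Submodule.mem_bot] at hy
      subst hy
      rfl
    · intro x
      obtain ⟨w, hw, hx⟩ := (hfst' ▸ Submodule.mem_top : x ∈ W.map (LinearMap.fst ℂ M N))
      exact ⟨⟨w, hw⟩, hx⟩
  have hq : Function.Bijective q := by
    constructor
    · rw [injective_iff_map_eq_zero]
      rintro ⟨⟨x, y⟩, hw⟩ (rfl : y = 0)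
      have hx : x ∈ W.comap (LinearMap.inl ℂ M N) := hw
      rw [hinl', Submodule.mem_bot] at hx
      subst hx
      rfl
    · intro y
      obtain ⟨w, hw, hy⟩ := (hsnd' ▸ Submodule.mem_top : y ∈ W.map (LinearMap.snd ℂ M N))
      exact ⟨⟨w, hw⟩, hy⟩
  refine ⟨(LinearEquiv.ofBijective p hp).symm ≪≫ₗ LinearEquiv.ofBijective q hq, fun n v w => ?_⟩
  obtain ⟨z, rfl⟩ := (LinearEquiv.ofBijective p hp).surjective w
  have e : S.mode n v (LinearEquiv.ofBijective p hp z) =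
      LinearEquiv.ofBijective p hp ⟨_, hW n v z z.2⟩ := rfl
  rw [e, LinearEquiv.trans_apply, LinearEquiv.trans_apply, LinearEquiv.symm_apply_apply,
    LinearEquiv.symm_apply_apply]
  rfl

end TwistedModule

open IsWeaklyAssociative in
theorem mainTheorem5 {V : Type*} [AddCommGroup V] [Module ℂ V] (A : VertexOperatorAlgebra V)
    (hA : A.IsSimple) (g : A.aut) (hg : IsOfFinOrder g)
    {M : Type*} [AddCommGroup M] [Module ℂ M] (S : TwistedModule A g M) (hS : S.IsIrreducible)
    {N : Type*} [AddCommGroup N] [Module ℂ N] (T : TwistedModule A g N) (hT : T.IsIrreducible)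
    (r s : ℤ) (h : (S.component r).IsIsomorphic (T.component s)) :
    S.IsIsomorphic T := by
  obtain ⟨φ, hφ⟩ := h
  have hST := S.isWeaklyAssociative.prod T.isWeaklyAssociative
  let X : Submodule ℂ (M × N) := LinearMap.range
    ((S.componentSpace r).subtype.prod ((T.componentSpace s).subtype ∘ₗ φ.toLinearMap))
  let W := generate (prodMode S.mode T.mode) X
  have hXW : X ≤ W := hST.le_generate X
  -- `V^0` preserves the graph, and the other `V^t` move it away from `M^r × N^s`
  have hle : W ≤ X ⊔ (S.componentCompl r).prod (T.componentCompl s) := by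
    refine generate_le hg fun t v hv n x hx => ?_
    obtain ⟨x, rfl⟩ := hx
    by_cases ht : (orderOf g : ℤ) ∣ t
    · rw [eigen_congr hg (b := 0) (by simpa using ht)] at hv
      refine Submodule.mem_sup_left ⟨(S.component r).mode n ⟨v, hv⟩ x, Prod.ext rfl ?_⟩
      exact congrArg Subtype.val (hφ n ⟨v, hv⟩ x)
    · exact Submodule.mem_sup_right
        ⟨TwistedModule.componentSpace_add_le hS hg r ht (S.mode_mem_componentSpace hv x.2 n),
          TwistedModule.componentSpace_add_le hT hg s ht
            (T.mode_mem_componentSpace hv (φ x).2 n)⟩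
  have hgraph : ∀ (x : S.componentSpace r) (y : T.componentSpace s),
      ((x : M), (y : N)) ∈ W → y = φ x := by
    intro x y hxy
    obtain ⟨_, ⟨x', rfl⟩, z, ⟨hz1, hz2⟩, he⟩ := Submodule.mem_sup.1 (hle hxy)
    have h1 : (x' : M) + z.1 = x := congrArg Prod.fst he
    have h2 : (φ x' : N) + z.2 = y := congrArg Prod.snd he
    have e1 : z.1 = 0 := by
      refine Submodule.disjoint_def.1 (S.disjoint_componentCompl r) _ ?_ hz1
      rw [eq_sub_iff_add_eq'.2 h1]
      exact Submodule.sub_mem _ x.2 x'.2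
    have e2 : z.2 = 0 := by
      refine Submodule.disjoint_def.1 (T.disjoint_componentCompl s) _ ?_ hz2
      rw [eq_sub_iff_add_eq'.2 h2]
      exact Submodule.sub_mem _ y.2 (φ x').2
    rw [e1, add_zero] at h1
    rw [e2, add_zero] at h2
    rw [← Subtype.ext h1]
    exact (Subtype.ext h2).symm
  obtain ⟨x, hx, hx0⟩ :=
    Submodule.exists_mem_ne_zero_of_ne_bot (TwistedModule.componentSpace_ne_bot hS hg hA r)
  obtain ⟨y, hy, hy0⟩ :=
    Submodule.exists_mem_ne_zero_of_ne_bot (TwistedModule.componentSpace_ne_bot hT hg hA s)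
  refine TwistedModule.isIsomorphic_of_prod_submodule hS hT W
    (fun n v w hw => hST.mode_generate_mem hg X n v hw) ?_ ?_ ?_ ?_
  · intro hbot
    have hm : x ∈ W.map (LinearMap.fst ℂ M N) := ⟨_, hXW ⟨⟨x, hx⟩, rfl⟩, rfl⟩
    rw [hbot, Submodule.mem_bot] at hm
    exact hx0 hm
  · intro hbot
    have hm : y ∈ W.map (LinearMap.snd ℂ M N) :=
      ⟨_, hXW ⟨φ.symm ⟨y, hy⟩, rfl⟩, by simp⟩
    rw [hbot, Submodule.mem_bot] at hm
    exact hy0 hm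
  · intro htop
    have hm : x ∈ W.comap (LinearMap.inl ℂ M N) := htop ▸ Submodule.mem_top
    have := hgraph ⟨x, hx⟩ 0 hm
    rw [eq_comm, LinearEquiv.map_eq_zero_iff] at this
    exact hx0 (congrArg Subtype.val this)
  · intro htop
    have hm : y ∈ W.comap (LinearMap.inr ℂ M N) := htop ▸ Submodule.mem_top
    have := hgraph 0 ⟨y, hy⟩ hm
    rw [map_zero] at this
    exact hy0 (congrArg Subtype.val this)

end
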